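/- Let $d \ge 2$ and $k \ge 1$ be integers. A *polytope* is the convex hull of a finite set of points of $\mathbb{R}^d$; write $\mathcal{V}(P)$ for the set of vertices of a polytope $P$. If $P \subset \mathbb{R}^d$ is a $d$-dimensional polytope, a point $x \in \mathbb{R}^d \setminus P$ *can be inserted* in $P$ if the vertex set of $\mathrm{conv}(P \cup \{x\})$ is exactly $\mathcal{V}(P) \cup \{x\}$, and the corresponding *insertion move* transforms $P$ into $\mathrm{conv}(P \cup \{x\})$. A vertex $v \in \mathcal{V}(P)$ *can be deleted* from $P$ if $\mathrm{conv}(\mathcal{V}(P) \setminus \{v\})$ is $d$-dimensional, and the corresponding *deletion move* transforms $P$ into $\mathrm{conv}(\mathcal{V}(P) \setminus \{v\})$. Let $\Lambda(d,k)$ be the graph whose vertices are the $d$-dimensional polytopes contained in the hypercube $[0,k]^d$ all of whose vertices belong to $\mathbb{Z}^d$, and in which two polytopes are adjacent when one is obtained from the other by an insertion move or a deletion move. Then $\Lambda(d,k)$ is connected: it has at least one vertex, and any two of its vertices are joined by a path. -/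

import Mathlib

/-- A convex polytope in `ℝ^d`: the convex hull of a finite set of points. -/
def IsPolytope {d : ℕ} (P : Set (Fin d → ℝ)) : Prop :=
  ∃ A : Set (Fin d → ℝ), A.Finite ∧ P = convexHull ℝ A

/-- The vertex set of a polytope: its extreme points. -/
def vertexSet {d : ℕ} (P : Set (Fin d → ℝ)) : Set (Fin d → ℝ) :=
  P.extremePoints ℝ

/-- A subset of `ℝ^d` is `d`-dimensional when its affine hull is all of `ℝ^d`. -/
def IsFullDim {d : ℕ} (P : Set (Fin d → ℝ)) : Prop :=
  affineSpan ℝ P = ⊤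

/-- The `d`-dimensional polytopes contained in `ℝ^d`. -/
def FullPolytope (d : ℕ) : Type :=
  {P : Set (Fin d → ℝ) // IsPolytope P ∧ IsFullDim P}

/-- The point `x`, outside of `P`, can be inserted in `P`: the vertices of the convex hull of
`P ∪ {x}` are exactly the vertices of `P` and `x`. -/
def CanInsert {d : ℕ} (P : Set (Fin d → ℝ)) (x : Fin d → ℝ) : Prop :=
  x ∉ P ∧ vertexSet (convexHull ℝ (P ∪ {x})) = vertexSet P ∪ {x}

/-- The vertex `v` of `P` can be deleted from `P`: the convex hull of the other vertices of `P`
is still `d`-dimensional. -/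
def CanDelete {d : ℕ} (P : Set (Fin d → ℝ)) (v : Fin d → ℝ) : Prop :=
  v ∈ vertexSet P ∧ IsFullDim (convexHull ℝ (vertexSet P \ {v}))

/-- `Q` is obtained from `P` by an insertion move. -/
def IsInsertionMove {d : ℕ} (P Q : Set (Fin d → ℝ)) : Prop :=
  ∃ x, CanInsert P x ∧ Q = convexHull ℝ (P ∪ {x})

/-- `Q` is obtained from `P` by a deletion move. -/
def IsDeletionMove {d : ℕ} (P Q : Set (Fin d → ℝ)) : Prop :=
  ∃ v, CanDelete P v ∧ Q = convexHull ℝ (vertexSet P \ {v})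

/-- The graph on the `d`-dimensional polytopes of `ℝ^d` in which two distinct polytopes are
adjacent when one is obtained from the other by an insertion move or a deletion move. -/
def polytopeGraph (d : ℕ) : SimpleGraph (FullPolytope d) :=
  SimpleGraph.fromRel fun P Q => IsInsertionMove P.1 Q.1 ∨ IsDeletionMove P.1 Q.1

/-- All vertices of `P` belong to the lattice `ℤ^d`. -/
def IsLatticePolytope {d : ℕ} (P : Set (Fin d → ℝ)) : Prop :=
  ∀ v ∈ vertexSet P, ∃ z : Fin d → ℤ, v = fun i => (z i : ℝ)

/-- The hypercube `[0,k]^d`. -/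
def hypercube (d k : ℕ) : Set (Fin d → ℝ) :=
  {x | ∀ i, 0 ≤ x i ∧ x i ≤ (k : ℝ)}

/-- The graph `Λ(d,k)`: the subgraph induced by the lattice polytopes contained in `[0,k]^d`. -/
def latticePolytopeGraph (d k : ℕ) :
    SimpleGraph {P : FullPolytope d | IsLatticePolytope P.1 ∧ P.1 ⊆ hypercube d k} :=
  (polytopeGraph d).induce {P : FullPolytope d | IsLatticePolytope P.1 ∧ P.1 ⊆ hypercube d k}

/-! Work with vertex sets: full-dimensional sets of lattice points of the cube in convex position.
Subsets of a set in convex position are in convex position, so two full-dimensional subsets of one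
such set are always joined by a path (`Linked.of_subset_of_subset`). It remains to find enough
common supersets to lead every vertex set to the corners of the cube.

Every vertex set contains a simplex `b`. Fix an axis direction `e` and write `e = ∑ g j • b j` with
`∑ g j = 0`. The point `b u + t • e` has barycentric coordinates `δ_{ju} + t g j`. If two of these
are positive and one is negative, the point is in convex position with the simplex, and it can
replace `b u` when its coordinate at `u` is nonzero. The replacement only rescales `g`, so its sign
pattern survives up to a global sign. A case analysis on the numbers of positive and negative
entries of `g` moves the vertices into two layers orthogonal to `e` (`exists_linked_two_layers`).

Sets in convex position in two distinct parallel hyperplanes have a union in convex position. One of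
the two layers can thus be enlarged by corner points until it spans its hyperplane, and the other
reduced to a single apex. The apex of this pyramid is moved over a corner of the cube, then to a
facet, which is filled with all its corners. A pyramid over that facet is treated in the same way,
which gives the whole cube. -/

/-! ### Polytopes of the graph as vertex sets -/

/-- The lattice points of the hypercube `[0,k]^d`. -/
def latticeCube (d k : ℕ) : Set (Fin d → ℝ) :=
  {x | ∀ i, ∃ m : ℕ, m ≤ k ∧ x i = m}

/-- No point of `V` belongs to the convex hull of the others. -/
def HullIndep {d : ℕ} (V : Set (Fin d → ℝ)) : Prop :=
  ∀ v ∈ V, v ∉ convexHull ℝ (V \ {v})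

/-- The vertex sets of the polytopes in `Λ(d,k)`. -/
structure IsLatticeVertexSet {d : ℕ} (k : ℕ) (V : Set (Fin d → ℝ)) : Prop where
  subset : V ⊆ latticeCube d k
  indep : HullIndep V
  full : affineSpan ℝ V = ⊤

theorem latticeCube_finite (d k : ℕ) : (latticeCube d k).Finite := by
  refine (Set.Finite.pi' (t := fun _ => (fun m : ℕ => (m : ℝ)) '' Set.Iic k)
    fun _ => (Set.finite_Iic k).image _).subset fun x hx i => ?_
  obtain ⟨m, hm, h⟩ := hx i
  exact ⟨m, hm, h.symm⟩

theorem latticeCube_subset_hypercube (d k : ℕ) : latticeCube d k ⊆ hypercube d k := by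
  intro x hx i
  obtain ⟨m, hm, h⟩ := hx i
  rw [h]
  exact ⟨m.cast_nonneg, by exact_mod_cast hm⟩

theorem mem_latticeCube_of_int {d k : ℕ} {x : Fin d → ℝ} (hx : x ∈ hypercube d k)
    (hz : ∃ z : Fin d → ℤ, x = fun i => (z i : ℝ)) : x ∈ latticeCube d k := by
  obtain ⟨z, rfl⟩ := hz
  intro i
  obtain ⟨h0, h1⟩ := hx i
  simp only at h0 h1
  have h0 : 0 ≤ z i := by exact_mod_cast h0
  have h1 : z i ≤ k := by exact_mod_cast h1
  refine ⟨(z i).toNat, by omega, ?_⟩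
  have : (((z i).toNat : ℤ) : ℝ) = z i := by rw [Int.toNat_of_nonneg h0]
  simp only
  exact_mod_cast this.symm

theorem exists_int_of_mem_latticeCube {d k : ℕ} {x : Fin d → ℝ} (hx : x ∈ latticeCube d k) :
    ∃ z : Fin d → ℤ, x = fun i => (z i : ℝ) := by
  choose m _ h using hx
  exact ⟨fun i => m i, funext fun i => by simp [h]⟩

theorem convex_hypercube (d k : ℕ) : Convex ℝ (hypercube d k) := by
  intro x hx y hy a b ha hb hab i
  obtain ⟨h1, h2⟩ := hx i
  obtain ⟨h3, h4⟩ := hy i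
  simp only [Pi.add_apply, Pi.smul_apply, smul_eq_mul]
  constructor
  · positivity
  · calc a * x i + b * y i ≤ a * k + b * k := by gcongr
      _ = k := by rw [← add_mul, hab, one_mul]

theorem convexHull_vertexSet {d : ℕ} {P : Set (Fin d → ℝ)} (hP : IsPolytope P) :
    (vertexSet P).Finite ∧ convexHull ℝ (vertexSet P) = P := by
  obtain ⟨A, hA, rfl⟩ := hP
  have hfin : (vertexSet (convexHull ℝ A)).Finite := hA.subset extremePoints_convexHull_subset
  refine ⟨hfin, ?_⟩
  have h := closure_convexHull_extremePoints (hA.isCompact_convexHull ℝ) (convex_convexHull ℝ A)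
  exact (IsClosed.closure_eq (hfin.isClosed_convexHull ℝ)).symm.trans h

theorem vertexSet_convexHull {d : ℕ} {V : Set (Fin d → ℝ)} (hfin : V.Finite)
    (hV : HullIndep V) : vertexSet (convexHull ℝ V) = V := by
  refine Set.Subset.antisymm extremePoints_convexHull_subset fun v hv => ?_
  by_contra hne
  refine hV v hv (convexHull_mono (s := vertexSet (convexHull ℝ V)) ?_ ?_)
  · intro w hw
    refine ⟨extremePoints_convexHull_subset hw, ?_⟩
    rintro rfl
    exact hne hw
  · rw [(convexHull_vertexSet ⟨V, hfin, rfl⟩).2]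
    exact subset_convexHull ℝ V hv

theorem HullIndep.mono {d : ℕ} {V W : Set (Fin d → ℝ)} (hW : HullIndep W) (h : V ⊆ W) :
    HullIndep V :=
  fun v hv hmem => hW v (h hv) (convexHull_mono (Set.sdiff_subset_sdiff_left h) hmem)

namespace IsLatticeVertexSet

variable {d k : ℕ} {V W : Set (Fin d → ℝ)}

theorem mono (hW : IsLatticeVertexSet k W) (h : V ⊆ W) (hV : affineSpan ℝ V = ⊤) :
    IsLatticeVertexSet k V where
  subset := h.trans hW.subset
  indep := hW.indep.mono h
  full := hV

theorem finite (hV : IsLatticeVertexSet k V) : V.Finite :=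
  (latticeCube_finite d k).subset hV.subset

theorem vertexSet_eq (hV : IsLatticeVertexSet k V) : vertexSet (convexHull ℝ V) = V :=
  vertexSet_convexHull hV.finite hV.indep

/-- The polytope with a given vertex set. -/
def polytope (hV : IsLatticeVertexSet k V) :
    {P : FullPolytope d | IsLatticePolytope P.1 ∧ P.1 ⊆ hypercube d k} :=
  ⟨⟨convexHull ℝ V, ⟨V, hV.finite, rfl⟩, by rw [IsFullDim, affineSpan_convexHull, hV.full]⟩,
    by
      refine ⟨?_, convexHull_min
        (hV.subset.trans (latticeCube_subset_hypercube d k)) (convex_hypercube d k)⟩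
      intro v hv
      exact exists_int_of_mem_latticeCube (hV.subset <| by simpa [hV.vertexSet_eq] using hv)⟩

theorem adj_insert {x : Fin d → ℝ} (hV : IsLatticeVertexSet k V)
    (hx : IsLatticeVertexSet k (insert x V)) (hxV : x ∉ V) :
    (latticePolytopeGraph d k).Adj hV.polytope hx.polytope := by
  have hmem : x ∉ convexHull ℝ V := by
    have := hx.indep x (Set.mem_insert _ _)
    rwa [Set.insert_sdiff_self_of_notMem hxV] at this
  have hhull : convexHull ℝ (convexHull ℝ V ∪ {x}) = convexHull ℝ (insert x V) := by
    rw [Set.union_singleton]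
    refine Set.Subset.antisymm (convexHull_min ?_ (convex_convexHull ℝ _))
      (convexHull_mono (Set.insert_subset_insert (subset_convexHull ℝ V)))
    exact Set.insert_subset (subset_convexHull ℝ _ (Set.mem_insert _ _))
      (convexHull_mono (Set.subset_insert _ _))
  have key : (polytopeGraph d).Adj hV.polytope.1 hx.polytope.1 := by
    refine ⟨fun h => ?_, Or.inl (Or.inl ⟨x, ⟨hmem, ?_⟩, hhull.symm⟩)⟩
    · have h2 : convexHull ℝ V = convexHull ℝ (insert x V) := congrArg Subtype.val h
      exact hmem (h2 ▸ subset_convexHull ℝ _ (Set.mem_insert _ _))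
    · change vertexSet (convexHull ℝ (convexHull ℝ V ∪ {x})) = vertexSet (convexHull ℝ V) ∪ {x}
      rw [hhull, hx.vertexSet_eq, hV.vertexSet_eq, Set.union_singleton]
  exact key

end IsLatticeVertexSet

/-! ### Paths through common supersets -/

/-- Two vertex sets are linked when their polytopes are joined by a path of `Λ(d,k)`. -/
def Linked {d : ℕ} (k : ℕ) (V W : Set (Fin d → ℝ)) : Prop :=
  ∃ (hV : IsLatticeVertexSet k V) (hW : IsLatticeVertexSet k W),
    (latticePolytopeGraph d k).Reachable hV.polytope hW.polytope

namespace Linked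

variable {d k : ℕ} {U V W : Set (Fin d → ℝ)}

theorem left (h : Linked k V W) : IsLatticeVertexSet k V := h.1

theorem right (h : Linked k V W) : IsLatticeVertexSet k W := h.2.1

theorem refl (hV : IsLatticeVertexSet k V) : Linked k V V := ⟨hV, hV, SimpleGraph.Reachable.refl _⟩

theorem symm (h : Linked k V W) : Linked k W V := ⟨h.2.1, h.1, h.2.2.symm⟩

theorem trans (h : Linked k U V) (h' : Linked k V W) : Linked k U W :=
  ⟨h.1, h'.2.1, h.2.2.trans h'.2.2⟩

/-- Add the missing points one at a time: each intermediate set lies between `V` and `W`, so it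
inherits convex position from `W` and full dimension from `V`. -/
theorem of_subset (hW : IsLatticeVertexSet k W) (h : V ⊆ W) (hV : affineSpan ℝ V = ⊤) :
    Linked k V W := by
  have hfull : ∀ D, affineSpan ℝ (V ∪ D) = ⊤ := fun D =>
    top_le_iff.1 (hV ▸ affineSpan_mono ℝ Set.subset_union_left)
  have key : ∀ D ⊆ W, Linked k V (V ∪ D) := by
    intro D hD
    induction D, hW.finite.subset hD using Set.Finite.induction_on with
    | empty =>
      rw [Set.union_empty]
      exact refl (hW.mono h hV)
    | @insert x D _ _ ih =>
      have ih := ih ((Set.subset_insert _ _).trans hD)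
      have hgood : IsLatticeVertexSet k (insert x (V ∪ D)) := by
        rw [← Set.union_insert]
        exact hW.mono (Set.union_subset h hD) (hfull _)
      rw [Set.union_insert]
      by_cases hx : x ∈ V ∪ D
      · rwa [Set.insert_eq_of_mem hx]
      · exact ih.trans ⟨ih.right, hgood, (ih.right.adj_insert hgood hx).reachable⟩
  have := key W subset_rfl
  rwa [Set.union_eq_self_of_subset_left h] at this

theorem of_subset_of_subset (hW : IsLatticeVertexSet k W) (hU : U ⊆ W) (hV : V ⊆ W)
    (hU' : affineSpan ℝ U = ⊤) (hV' : affineSpan ℝ V = ⊤) : Linked k U V :=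
  (of_subset hW hU hU').trans (of_subset hW hV hV').symm

end Linked

theorem exists_polytope_eq {d k : ℕ}
    (P : {P : FullPolytope d | IsLatticePolytope P.1 ∧ P.1 ⊆ hypercube d k}) :
    ∃ (V : Set (Fin d → ℝ)) (hV : IsLatticeVertexSet k V), hV.polytope = P := by
  obtain ⟨⟨P, hP, hfull⟩, hlat, hsub⟩ := P
  obtain ⟨hfin, hhull⟩ := convexHull_vertexSet hP
  have hconv : Convex ℝ P := hhull ▸ convex_convexHull ℝ _
  refine ⟨vertexSet P, ⟨fun v hv => mem_latticeCube_of_int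
    (hsub (extremePoints_subset hv)) (hlat v hv), ?_, ?_⟩,
    Subtype.ext (Subtype.ext hhull)⟩
  · exact convexIndependent_set_iff_notMem_convexHull_sdiff.1 hconv.convexIndependent_extremePoints
  · rw [← affineSpan_convexHull, hhull]
    exact hfull

/-- It is enough to link every vertex set to a fixed one. -/
theorem connected_of_linked {d k : ℕ} {W : Set (Fin d → ℝ)} (hW : IsLatticeVertexSet k W)
    (h : ∀ V, IsLatticeVertexSet k V → Linked k V W) : (latticePolytopeGraph d k).Connected where
  nonempty := ⟨hW.polytope⟩
  preconnected P Q := by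
    obtain ⟨V, hV, rfl⟩ := exists_polytope_eq P
    obtain ⟨U, hU, rfl⟩ := exists_polytope_eq Q
    exact ((h V hV).trans (h U hU).symm).2.2

/-! ### Convex position from faces, layers and corner lines -/

/-- The hyperplane `f = c` supports `A ∪ B` and cuts its hull exactly in the hull of `A`: the union
of that hull with the open half-space `f < c` is already convex. -/
theorem notMem_convexHull_union {d : ℕ} (f : (Fin d → ℝ) →ₗ[ℝ] ℝ) {c : ℝ}
    {A B : Set (Fin d → ℝ)} {v : Fin d → ℝ} (hA : ∀ a ∈ A, f a = c) (hB : ∀ b ∈ B, f b < c)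
    (hv : f v = c) (hvA : v ∉ convexHull ℝ A) : v ∉ convexHull ℝ (A ∪ B) := by
  have hAc : ∀ a ∈ convexHull ℝ A, f a = c := fun a ha =>
    convexHull_min (t := {y | f y = c}) hA (convex_hyperplane f.isLinear c) ha
  have hconv : Convex ℝ (convexHull ℝ A ∪ {y | f y < c}) := by
    rw [convex_iff_forall_pos]
    rintro x hx y hy a b ha hb hab
    have hcc : c = a * c + b * c := by rw [← add_mul, hab, one_mul]
    rcases hx with hx | hx <;> rcases hy with hy | hy
    · exact Or.inl (convex_convexHull ℝ A hx hy ha.le hb.le hab)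
    all_goals
      right
      simp only [Set.mem_ofPred_eq, map_add, map_smul, smul_eq_mul] at hx hy ⊢
      try rw [hAc x hx]
      try rw [hAc y hy]
      nlinarith
  intro h
  rcases convexHull_min (Set.union_subset_union (subset_convexHull ℝ A) hB) hconv h with h | h
  · exact hvA h
  · exact (show f v < c from h).ne hv

/-- The points of `A` are vertices of the convex hull of `A ∪ B` when `A` lies in a coordinate
hyperplane and `B` strictly on one side of it. -/
theorem notMem_convexHull_layer {d : ℕ} (i : Fin d) {s : ℝ} (σ : ℝ) {A B : Set (Fin d → ℝ)}
    (hA : ∀ a ∈ A, a i = s) (hAi : HullIndep A) (hB : ∀ b ∈ B, σ * b i < σ * s) :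
    ∀ v ∈ A, v ∉ convexHull ℝ ((A ∪ B) \ {v}) := by
  intro v hv h
  refine notMem_convexHull_union (σ • LinearMap.proj i) (c := σ * s) (A := A \ {v}) (B := B)
    (fun a ha => by simp [hA a ha.1]) (fun b hb => by simpa using hB b hb)
    (by simp [hA v hv]) (hAi v hv) (convexHull_mono ?_ h)
  rw [Set.union_sdiff_distrib]
  exact Set.union_subset_union_right _ Set.sdiff_subset

theorem HullIndep.union {d : ℕ} (i : Fin d) {s t : ℝ} (hst : s ≠ t) {A B : Set (Fin d → ℝ)}
    (hA : ∀ a ∈ A, a i = s) (hB : ∀ b ∈ B, b i = t) (hAi : HullIndep A) (hBi : HullIndep B) :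
    HullIndep (A ∪ B) := by
  -- Scaling the coordinate by `s - t` or `t - s` avoids distinguishing which layer is higher.
  have hpos : 0 < (s - t) * (s - t) := mul_self_pos.2 (sub_ne_zero.2 hst)
  rintro v (hv | hv)
  · exact notMem_convexHull_layer i (s - t) hA hAi (fun b hb => by rw [hB b hb]; linarith) v hv
  · rw [Set.union_comm]
    exact notMem_convexHull_layer i (t - s) hB hBi (fun b hb => by rw [hA b hb]; linarith) v hv

theorem HullIndep.singleton {d : ℕ} (x : Fin d → ℝ) : HullIndep {x} := by
  rintro v rfl
  simp

theorem HullIndep.pair {d : ℕ} {x y : Fin d → ℝ} (h : x ≠ y) : HullIndep {x, y} := by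
  rintro v (rfl | rfl)
  · simp [h]
  · rw [Set.pair_comm]
    simp [h.symm]

/-- A point in the vertical line through a vertex of the hypercube is only in the convex hull of
points of the hypercube when some of them also lie in that line, at the right heights. -/
theorem notMem_convexHull_of_corner {d k : ℕ} (i : Fin d) {v : Fin d → ℝ} {s : ℝ}
    {W : Set (Fin d → ℝ)} (hv : ∀ j ≠ i, v j = 0 ∨ v j = k) (hW : W ⊆ hypercube d k)
    (hs : ∀ w ∈ W, (∀ j ≠ i, w j = v j) → w i = s) (hvs : v i ≠ s) : v ∉ convexHull ℝ W := by
  classical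
  -- On the cube, this signed sum of the coordinates other than `i` is maximal exactly on the line
  -- through `v`.
  let f : (Fin d → ℝ) →ₗ[ℝ] ℝ :=
    ∑ j ∈ Finset.univ.erase i, (if v j = k then (1 : ℝ) else -1) • LinearMap.proj j
  have hf : ∀ y, f y = ∑ j ∈ Finset.univ.erase i, (if v j = k then (1 : ℝ) else -1) * y j := by
    intro y
    simp only [f, LinearMap.sum_apply, LinearMap.smul_apply, LinearMap.proj_apply, smul_eq_mul]
  have hle : ∀ w ∈ W, ∀ j ∈ Finset.univ.erase i,
      (if v j = k then (1 : ℝ) else -1) * w j ≤ (if v j = k then (1 : ℝ) else -1) * v j := by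
    intro w hw j hj
    obtain ⟨h0, h1⟩ := hW hw j
    split_ifs with h
    · linarith
    · rw [(hv j (Finset.ne_of_mem_erase hj)).resolve_right h]
      linarith
  have hA : ∀ w, (∀ j ≠ i, w j = v j) → f w = f v := by
    intro w hw
    rw [hf, hf]
    exact Finset.sum_congr rfl fun j hj => by rw [hw j (Finset.ne_of_mem_erase hj)]
  have hB : ∀ w ∈ W, ¬ (∀ j ≠ i, w j = v j) → f w < f v := by
    intro w hw hne
    push Not at hne
    obtain ⟨j, hj, hne⟩ := hne
    rw [hf, hf]
    refine Finset.sum_lt_sum (hle w hw) ⟨j, by simp [hj], lt_of_le_of_ne (hle w hw j (by simp [hj])) ?_⟩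
    intro h
    refine hne (mul_left_cancel₀ ?_ h)
    split_ifs <;> norm_num
  intro h
  refine notMem_convexHull_union f (c := f v) (A := {w ∈ W | ∀ j ≠ i, w j = v j})
    (B := {w ∈ W | ¬ ∀ j ≠ i, w j = v j}) (fun w hw => hA w hw.2) (fun w hw => hB w hw.1 hw.2) rfl
    ?_ (convexHull_mono ?_ h)
  · intro h
    exact hvs (convexHull_min (t := {y | LinearMap.proj (R := ℝ) (φ := fun _ => ℝ) i y = s})
      (fun w hw => hs w hw.1 hw.2) (convex_hyperplane (LinearMap.isLinear _) s) h)
  · intro w hw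
    by_cases h : ∀ j ≠ i, w j = v j
    · exact Or.inl ⟨hw, h⟩
    · exact Or.inr ⟨hw, h⟩

/-- The points at height `t` in the vertical lines through the vertices of the hypercube. -/
def cornerLayer {d : ℕ} (k : ℕ) (i : Fin d) (t : ℝ) : Set (Fin d → ℝ) :=
  {y | y i = t ∧ ∀ j ≠ i, y j = 0 ∨ y j = k}

theorem cornerLayer_subset {d k m : ℕ} (i : Fin d) (hm : m ≤ k) :
    cornerLayer k i m ⊆ latticeCube d k := by
  rintro y ⟨hy, hy'⟩ j
  rcases eq_or_ne j i with rfl | hj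
  · exact ⟨m, hm, hy⟩
  · rcases hy' j hj with h | h
    · exact ⟨0, Nat.zero_le _, by simpa using h⟩
    · exact ⟨k, le_rfl, h⟩

theorem hullIndep_cornerLayer {d k m : ℕ} (i : Fin d) (hm : m ≤ k) :
    HullIndep (cornerLayer k i (m : ℝ)) := by
  intro v hv
  -- The height `v i + 1` is arbitrary: no other point of the layer lies on the line through `v`.
  refine notMem_convexHull_of_corner i (s := v i + 1) hv.2 (Set.sdiff_subset.trans
    ((cornerLayer_subset i hm).trans (latticeCube_subset_hypercube d k))) ?_ (by simp)
  rintro w ⟨hw, hne⟩ h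
  refine absurd (funext fun j => ?_) hne
  rcases eq_or_ne j i with rfl | hj
  · rw [hw.1, hv.1]
  · exact h j hj

/-- Differences of corners give every axis direction except `i`, and `u`, being off the layer,
supplies the last one. -/
theorem affineSpan_insert_cornerLayer {d k : ℕ} (hk : 0 < k) (i : Fin d) {t : ℝ} {u : Fin d → ℝ}
    (hu : u i ≠ t) : affineSpan ℝ (insert u (cornerLayer k i t)) = ⊤ := by
  classical
  set S := affineSpan ℝ (insert u (cornerLayer k i t)) with hS
  have hk' : (k : ℝ) ≠ 0 := by positivity
  have hmem : ∀ y ∈ cornerLayer k i t, y ∈ S := fun y hy =>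
    subset_affineSpan ℝ _ (Set.mem_insert_of_mem _ hy)
  have huS : u ∈ S := subset_affineSpan ℝ _ (Set.mem_insert _ _)
  let q : Fin d → ℝ := Pi.single i t
  have hq : q ∈ cornerLayer k i t := ⟨by simp [q], fun j hj => by simp [q, hj]⟩
  have hj : ∀ j ≠ i, Pi.single j (1 : ℝ) ∈ S.direction := by
    intro j hj
    have h1 : q + Pi.single j (k : ℝ) ∈ cornerLayer k i t := by
      refine ⟨by simp [q, hj.symm], fun l hl => ?_⟩
      rcases eq_or_ne l j with rfl | h
      · right; simp [q, hl]
      · left; simp [q, hl, h]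
    have h2 := AffineSubspace.vsub_mem_direction (hmem _ h1) (hmem _ hq)
    have h3 := S.direction.smul_mem (k : ℝ)⁻¹ h2
    rw [vsub_eq_sub, add_sub_cancel_left, ← Pi.single_smul', smul_eq_mul,
      inv_mul_cancel₀ hk'] at h3
    exact h3
  have hi : Pi.single i (1 : ℝ) ∈ S.direction := by
    have h2 := AffineSubspace.vsub_mem_direction huS (hmem _ hq)
    have h3 : (u - q) - ∑ j ∈ Finset.univ.erase i, (u j) • (Pi.single j 1 : Fin d → ℝ)
        ∈ S.direction :=
      S.direction.sub_mem h2 (S.direction.sum_mem fun j hj' =>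
        S.direction.smul_mem _ (hj j (Finset.ne_of_mem_erase hj')))
    have h4 : (u - q) - ∑ j ∈ Finset.univ.erase i, (u j) • (Pi.single j 1 : Fin d → ℝ)
        = (u i - t) • (Pi.single i (1 : ℝ) : Fin d → ℝ) := by
      ext l
      rcases eq_or_ne l i with rfl | hl
      · simp [q, Finset.sum_apply, Pi.single_apply]
      · simp [q, Finset.sum_apply, Pi.single_apply, hl]
    rw [h4] at h3
    have h5 := S.direction.smul_mem (u i - t)⁻¹ h3
    rwa [smul_smul, inv_mul_cancel₀ (sub_ne_zero.2 hu), one_smul] at h5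
  have hdir : S.direction = ⊤ := by
    rw [eq_top_iff]
    intro y _
    rw [pi_eq_sum_univ' y]
    refine S.direction.sum_mem fun j _ => S.direction.smul_mem _ ?_
    rcases eq_or_ne j i with rfl | h
    · exact hi
    · exact hj j h
  exact (AffineSubspace.direction_eq_top_iff_of_nonempty ⟨u, huS⟩).1 hdir

/-- Write `w = r (v - u) + a` with `u` and `a` in the span of `A`. Since `w` is off the hyperplane,
`r ≠ 0`, and `v` can be recovered from `w`. -/
theorem affineSpan_insert_eq_top_of_layer {d : ℕ} (i : Fin d) {s : ℝ} {A : Set (Fin d → ℝ)}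
    (hA : ∀ a ∈ A, a i = s) (hne : A.Nonempty) {v w : Fin d → ℝ}
    (hv : affineSpan ℝ (insert v A) = ⊤) (hw : w i ≠ s) : affineSpan ℝ (insert w A) = ⊤ := by
  obtain ⟨u, hu⟩ := hne
  have huA : u ∈ affineSpan ℝ A := subset_affineSpan ℝ _ hu
  have hspan : ∀ a ∈ affineSpan ℝ A, a i = s := by
    intro a ha
    have : affineSpan ℝ A ≤ (AffineSubspace.mk' s ⊥).comap
        (LinearMap.proj (R := ℝ) (φ := fun _ : Fin d => ℝ) i).toAffineMap :=
      affineSpan_le.2 fun b hb => by simp [hA b hb, AffineSubspace.mem_mk']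
    simpa [AffineSubspace.mem_mk', sub_eq_zero] using this ha
  have hwv : w ∈ affineSpan ℝ (insert v (affineSpan ℝ A : Set (Fin d → ℝ))) := by
    rw [affineSpan_insert_affineSpan, hv]
    trivial
  obtain ⟨r, a, ha, hwa⟩ := (AffineSubspace.mem_affineSpan_insert_iff huA v w).1 hwv
  have hr : r ≠ 0 := by
    rintro rfl
    exact hw (by simpa [hspan a ha] using congrFun hwa i)
  have hmem : v ∈ affineSpan ℝ (insert w (affineSpan ℝ A : Set (Fin d → ℝ))) := by
    refine (AffineSubspace.mem_affineSpan_insert_iff ha w v).2 ⟨r⁻¹, u, huA, ?_⟩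
    rw [hwa]
    ext l
    simp
    field_simp
    ring
  rw [affineSpan_insert_affineSpan] at hmem
  rw [eq_top_iff, ← hv]
  exact affineSpan_le.2 (Set.insert_subset hmem
    ((Set.subset_insert _ _).trans (subset_affineSpan ℝ _)))

/-- The points of a layer, together with two points lying above two different vertices of the
hypercube at increasing distances from this layer, are in convex position. -/
theorem hullIndep_layer_union_pair {d k : ℕ} (i : Fin d) {s : ℝ} {A : Set (Fin d → ℝ)}
    (hA : ∀ a ∈ A, a i = s) (hAi : HullIndep A) (hAk : A ⊆ hypercube d k) {p q : Fin d → ℝ}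
    (hp : ∀ j ≠ i, p j = 0 ∨ p j = k) (hpk : p ∈ hypercube d k)
    (hqk : q ∈ hypercube d k) {j : Fin d} (hj : j ≠ i)
    (hpq : p j ≠ q j) (h1 : 0 < (p i - s) * (q i - s)) (h2 : 0 < (q i - s) * (q i - p i)) :
    HullIndep (A ∪ {p, q}) := by
  have hps : p i ≠ s := fun h => by simp [h] at h1
  have hqs : q i ≠ s := fun h => by simp [h] at h1
  rintro x (hx | rfl | rfl)
  · refine notMem_convexHull_layer i (s - p i) hA hAi ?_ x hx
    rintro b (rfl | rfl)
    · nlinarith [mul_self_pos.2 (sub_ne_zero.2 hps)]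
    · nlinarith
  · refine notMem_convexHull_of_corner i (s := s) hp
      (Set.sdiff_subset.trans (Set.union_subset hAk (Set.pair_subset hpk hqk))) ?_ hps
    rintro w ⟨hw | rfl | rfl, hne⟩ hw'
    · exact hA w hw
    · exact absurd rfl hne
    · exact absurd (hw' j hj).symm hpq
  · have := notMem_convexHull_layer i (s := x i) (A := {x}) (B := A ∪ {p}) (x i - s)
      (by simp) (HullIndep.singleton x) ?_ x rfl
    · rwa [Set.union_comm, Set.union_assoc, ← Set.insert_eq] at this
    · rintro b (hb | rfl)
      · rw [hA b hb]
        nlinarith [mul_self_pos.2 (sub_ne_zero.2 hqs)]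
      · nlinarith

/-! ### Pyramids over a layer -/

theorem IsLatticeVertexSet.exists_ne {d k : ℕ} (i : Fin d) {V : Set (Fin d → ℝ)}
    (hV : IsLatticeVertexSet k V) (s : ℝ) : ∃ v ∈ V, v i ≠ s := by
  by_contra! h
  have : affineSpan ℝ V ≤ (AffineSubspace.mk' s ⊥).comap
      (LinearMap.proj (R := ℝ) (φ := fun _ : Fin d => ℝ) i).toAffineMap :=
    affineSpan_le.2 fun b hb => by simp [h b hb, AffineSubspace.mem_mk']
  rw [hV.full] at this
  have := @this (fun _ => s + 1) trivial
  simp [AffineSubspace.mem_mk'] at this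

/-- A pyramid whose base lies in a layer is linked to the polytopes obtained by replacing its apex
with the corners of an opposite facet of the hypercube. -/
theorem exists_linked_union_cornerLayer {d k : ℕ} (hd : 2 ≤ d) (hk : 0 < k) (i : Fin d) {s : ℝ}
    {A : Set (Fin d → ℝ)} (hA : ∀ a ∈ A, a i = s) (hne : A.Nonempty) {v : Fin d → ℝ}
    (hv : v i ≠ s) (h : IsLatticeVertexSet k (insert v A)) :
    ∃ m : ℕ, (m = 0 ∨ m = k) ∧ (m : ℝ) ≠ s ∧
      Linked k (insert v A) (A ∪ cornerLayer k i (m : ℝ)) := by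
  classical
  have hcube := latticeCube_subset_hypercube d k
  have hvk : v ∈ latticeCube d k := h.subset (Set.mem_insert _ _)
  have hAk : A ⊆ latticeCube d k := (Set.subset_insert _ _).trans h.subset
  have hAi : HullIndep A := h.indep.mono (Set.subset_insert _ _)
  have hfull : ∀ w : Fin d → ℝ, w i ≠ s → affineSpan ℝ (insert w A) = ⊤ := fun w hw =>
    affineSpan_insert_eq_top_of_layer i hA hne h.full hw
  have hfull' : ∀ w : Fin d → ℝ, w i ≠ s → ∀ W, insert w A ⊆ W → affineSpan ℝ W = ⊤ :=
    fun w hw W hW => top_le_iff.1 (hfull w hw ▸ affineSpan_mono ℝ hW)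
  obtain ⟨j, hj⟩ : ∃ j : Fin d, j ≠ i := by
    have : Nontrivial (Fin d) := Fin.nontrivial_iff_two_le.2 hd
    exact exists_ne i
  obtain ⟨n, hn, hvn⟩ := hvk i
  -- The facet at height `m` is on the same side of the base as `v`, at least as far away.
  obtain ⟨m, hm, hms, hm2⟩ : ∃ m : ℕ, (m = 0 ∨ m = k) ∧ 0 < (v i - s) * (m - s) ∧
      ((m : ℝ) ≠ v i → 0 < ((m : ℝ) - s) * (m - v i)) := by
    have hv1 := hcube hvk i
    rcases lt_or_gt_of_ne hv with hlt | hlt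
    · refine ⟨0, Or.inl rfl, ?_, fun hne => ?_⟩
      · rw [Nat.cast_zero]
        exact mul_pos_of_neg_of_neg (by linarith) (by linarith)
      · rw [Nat.cast_zero] at *
        exact mul_pos_of_neg_of_neg (by linarith) (by linarith [lt_of_le_of_ne hv1.1 hne])
    · refine ⟨k, Or.inr rfl, ?_, fun hne => ?_⟩
      · exact mul_pos (by linarith) (by linarith)
      · exact mul_pos (by linarith) (by linarith [lt_of_le_of_ne hv1.2 hne.symm])
  have hmk : m ≤ k := by omega
  have hms' : (m : ℝ) ≠ s := fun h => by simp [h] at hms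
  -- The apex goes from `v` to `p`, over the corner with coordinates `c`, then to `q`, over the one
  -- with coordinates `c'`. Here `c ≠ v j` makes `p` differ from `v`, and `c ≠ c'` puts `p` and `q`
  -- on different vertical lines.
  obtain ⟨c, c', hc, hc', hcc, hcv⟩ : ∃ c c' : ℕ, (c = 0 ∨ c = k) ∧ (c' = 0 ∨ c' = k) ∧ c ≠ c' ∧
      (c : ℝ) ≠ v j := by
    by_cases h0 : v j = 0
    · refine ⟨k, 0, Or.inr rfl, Or.inl rfl, hk.ne', ?_⟩
      rw [h0]
      exact_mod_cast hk.ne'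
    · exact ⟨0, k, Or.inl rfl, Or.inr rfl, hk.ne, by rw [Nat.cast_zero]; exact Ne.symm h0⟩
  let p : Fin d → ℝ := fun l => if l = i then v i else c
  let q : Fin d → ℝ := fun l => if l = i then m else c'
  have hpi : p i = v i := if_pos rfl
  have hqi : q i = m := if_pos rfl
  have hpj : ∀ l ≠ i, p l = c := fun l hl => if_neg hl
  have hqj : ∀ l ≠ i, q l = c' := fun l hl => if_neg hl
  have hpC : p ∈ cornerLayer k i (n : ℝ) :=
    ⟨hpi.trans hvn, fun l hl => by rw [hpj l hl]; exact_mod_cast hc⟩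
  have hqC : q ∈ cornerLayer k i (m : ℝ) :=
    ⟨hqi, fun l hl => by rw [hqj l hl]; exact_mod_cast hc'⟩
  have hpk := cornerLayer_subset i hn hpC
  have hqk := cornerLayer_subset i hmk hqC
  have hpv : v ≠ p := fun h => hcv (by rw [← hpj j hj, ← h])
  have hgood1 : IsLatticeVertexSet k (A ∪ {v, p}) := by
    refine ⟨Set.union_subset hAk (Set.pair_subset hvk hpk), ?_, hfull' v hv _ ?_⟩
    · refine HullIndep.union i (Ne.symm hv) hA ?_ hAi (HullIndep.pair hpv)
      rintro b (rfl | rfl)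
      exacts [rfl, hpi]
    · exact Set.insert_subset (by simp) Set.subset_union_left
  have hgood2 : IsLatticeVertexSet k (A ∪ cornerLayer k i (m : ℝ)) :=
    ⟨Set.union_subset hAk (cornerLayer_subset i hmk),
      HullIndep.union i hms'.symm hA (fun b hb => hb.1) hAi (hullIndep_cornerLayer i hmk),
      hfull' q (by rwa [hqi]) _ (Set.insert_subset (Or.inr hqC) Set.subset_union_left)⟩
  have hvp : Linked k (insert v A) (insert p A) :=
    Linked.of_subset_of_subset hgood1 (Set.insert_subset (by simp) Set.subset_union_left)
      (Set.insert_subset (by simp) Set.subset_union_left) h.full (hfull p (by rwa [hpi]))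
  refine ⟨m, hm, hms', hvp.trans ?_⟩
  by_cases hmv : (m : ℝ) = v i
  · refine Linked.of_subset hgood2 (Set.insert_subset (Or.inr ?_) Set.subset_union_left)
      hvp.right.full
    rw [hmv, hvn]
    exact hpC
  · have hgood3 : IsLatticeVertexSet k (A ∪ {p, q}) := by
      refine ⟨Set.union_subset hAk (Set.pair_subset hpk hqk), ?_,
        hfull' p (by rwa [hpi]) _ (Set.insert_subset (by simp) Set.subset_union_left)⟩
      refine hullIndep_layer_union_pair (k := k) i hA hAi (hAk.trans hcube) ?_ (hcube hpk)
        (hcube hqk) hj ?_ ?_ ?_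
      · exact hpC.2
      · rw [hpj j hj, hqj j hj]
        exact_mod_cast hcc
      · rwa [hpi, hqi]
      · rw [hpi, hqi]
        exact hm2 hmv
    refine (Linked.of_subset_of_subset hgood3 (U := insert p A) (V := insert q A)
      (Set.insert_subset (by simp) Set.subset_union_left) (Set.insert_subset (by simp) Set.subset_union_left)
      hvp.right.full (hfull q (by rwa [hqi]))).trans ?_
    exact Linked.of_subset hgood2 (Set.insert_subset (Or.inr hqC) Set.subset_union_left)
      (hfull q (by rwa [hqi]))

/-- The vertices of the hypercube `[0,k]^d`. -/
def cubeCorners (d k : ℕ) : Set (Fin d → ℝ) :=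
  {y | ∀ j, y j = 0 ∨ y j = k}

theorem cornerLayer_union_cornerLayer {d k : ℕ} (i : Fin d) :
    cornerLayer k i 0 ∪ cornerLayer k i (k : ℝ) = cubeCorners d k := by
  ext y
  constructor
  · rintro (⟨h, h'⟩ | ⟨h, h'⟩) j <;> rcases eq_or_ne j i with rfl | hj
    exacts [Or.inl h, h' j hj, Or.inr h, h' j hj]
  · intro h
    exact (h i).imp (fun hi => ⟨hi, fun j _ => h j⟩) (fun hi => ⟨hi, fun j _ => h j⟩)

/-- Apply the apex replacement twice: once over `A`, then over the facet so obtained, with a point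
of `A` as the new apex. The second facet must be the opposite one. -/
theorem linked_cubeCorners_of_pyramid {d k : ℕ} (hd : 2 ≤ d) (hk : 0 < k) (i : Fin d) {s : ℝ}
    {A : Set (Fin d → ℝ)} (hA : ∀ a ∈ A, a i = s) (hne : A.Nonempty) {v : Fin d → ℝ}
    (hv : v i ≠ s) (h : IsLatticeVertexSet k (insert v A)) :
    Linked k (insert v A) (cubeCorners d k) := by
  obtain ⟨m, hm, hms, hlink⟩ := exists_linked_union_cornerLayer hd hk i hA hne hv h
  obtain ⟨u, hu⟩ := hne
  have hum : u i ≠ m := by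
    rw [hA u hu]
    exact hms.symm
  have hlink2 : Linked k (insert u (cornerLayer k i (m : ℝ))) (A ∪ cornerLayer k i (m : ℝ)) :=
    Linked.of_subset hlink.right (Set.insert_subset (Or.inl hu) Set.subset_union_right)
      (affineSpan_insert_cornerLayer hk i hum)
  have hC : (cornerLayer k i (m : ℝ)).Nonempty :=
    ⟨Pi.single i (m : ℝ), by simp, fun j hj => by simp [hj]⟩
  obtain ⟨n, hn, hnm, hlink3⟩ :=
    exists_linked_union_cornerLayer hd hk i (fun a ha => ha.1) hC hum hlink2.left
  have hnm : n ≠ m := by exact_mod_cast hnm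
  have : cornerLayer k i (m : ℝ) ∪ cornerLayer k i (n : ℝ) = cubeCorners d k := by
    rw [← cornerLayer_union_cornerLayer i]
    rcases hm with rfl | rfl <;> rcases hn with rfl | rfl
    · exact absurd rfl hnm
    · simp
    · rw [Set.union_comm]; simp
    · exact absurd rfl hnm
  exact (hlink.trans hlink2.symm).trans (this ▸ hlink3)

/-! ### From two layers to the cube -/

/-- If `v ∈ E` were a convex combination of `q` and some `y` in the hull of the other points, with
positive weight on `q`, then solving for `q` would put it in the affine span of `E`. -/
theorem HullIndep.insert {d : ℕ} {E : Set (Fin d → ℝ)} (hE : HullIndep E) {q : Fin d → ℝ}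
    (hq : q ∉ affineSpan ℝ E) : HullIndep (insert q E) := by
  have hqE : q ∉ E := fun h => hq (subset_affineSpan ℝ _ h)
  rintro v (rfl | hv) h
  · rw [Set.insert_sdiff_self_of_notMem hqE] at h
    exact hq (convexHull_subset_affineSpan E h)
  · have hne : q ≠ v := by
      rintro rfl
      exact hqE hv
    rw [Set.insert_sdiff_of_notMem _ (by simpa using hne)] at h
    rcases (E \ {v}).eq_empty_or_nonempty with h0 | h0
    · rw [h0] at h
      simp at h
      exact hne h.symm
    rw [convexHull_insert h0, convexJoin_singleton_left] at h
    simp only [Set.mem_iUnion] at h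
    obtain ⟨y, hy, hvy⟩ := h
    obtain ⟨a, b, ha, hb, hab, rfl⟩ := hvy
    rcases ha.eq_or_lt with rfl | ha
    · refine hE _ hv ?_
      have : b = 1 := by linarith
      simpa [this] using hy
    · refine hq ?_
      have hyS : y ∈ affineSpan ℝ E :=
        affineSpan_mono ℝ Set.sdiff_subset (convexHull_subset_affineSpan _ hy)
      have hvS := subset_affineSpan ℝ E hv
      have hline := AffineMap.lineMap_mem (Q := affineSpan ℝ E) a⁻¹ hyS hvS
      convert hline using 1
      rw [AffineMap.lineMap_apply_module, smul_add, smul_smul, smul_smul,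
        inv_mul_cancel₀ ha.ne', one_smul, add_left_comm, ← add_smul]
      have : 1 - a⁻¹ + a⁻¹ * b = 0 := by
        rw [show b = 1 - a by linarith]
        field_simp
        ring
      rw [this, zero_smul, add_zero]

/-- Enlarge the layer `V₁` by corners to a maximal set `E` in convex position. Then `V₀ ∪ E`
contains both `V` and a full-dimensional pyramid over `E`. -/
theorem linked_cubeCorners_of_two_layers {d k : ℕ} (hd : 2 ≤ d) (hk : 0 < k) (i : Fin d) {s t : ℝ}
    {V : Set (Fin d → ℝ)} (h : IsLatticeVertexSet k V) (hV : ∀ v ∈ V, v i = s ∨ v i = t) :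
    Linked k V (cubeCorners d k) := by
  obtain ⟨u, hu, hut⟩ := h.exists_ne i t
  obtain ⟨w, hw, hws⟩ := h.exists_ne i s
  have hus := (hV u hu).resolve_right hut
  have hwt := (hV w hw).resolve_left hws
  have hst : s ≠ t := fun h => hws (hwt.trans h.symm)
  obtain ⟨m, hm, hwm⟩ := h.subset hw i
  obtain rfl : t = m := hwt.symm.trans hwm
  have hQ := cornerLayer_subset (d := d) i hm
  set Q := cornerLayer k i (m : ℝ) with hQdef
  set V₀ := {v ∈ V | v i = s}
  set V₁ := {v ∈ V | v i = m}
  have hVV : V = V₀ ∪ V₁ := by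
    ext v
    exact ⟨fun hv => (hV v hv).imp (⟨hv, ·⟩) (⟨hv, ·⟩), fun hv => hv.elim (·.1) (·.1)⟩
  let F : Set (Set (Fin d → ℝ)) := {E | V₁ ⊆ E ∧ E ⊆ V₁ ∪ Q ∧ HullIndep E}
  have hVk : V₁ ∪ Q ⊆ latticeCube d k := Set.union_subset ((Set.sep_subset _ _).trans h.subset) hQ
  have hfin : F.Finite :=
    ((latticeCube_finite d k).subset hVk).finite_subsets.subset fun E hE => hE.2.1
  obtain ⟨E, ⟨hE1, hE2, hE3⟩, hmax⟩ := hfin.exists_maximal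
    ⟨V₁, subset_rfl, Set.subset_union_left, h.indep.mono (Set.sep_subset _ _)⟩
  have hEm : ∀ e ∈ E, e i = m := fun e he => (hE2 he).elim (·.2) (·.1)
  have hspan : affineSpan ℝ (insert u E) = ⊤ := by
    rw [eq_top_iff, ← affineSpan_insert_cornerLayer hk i hut]
    refine affineSpan_le.2 (Set.insert_subset (subset_affineSpan ℝ _ (Set.mem_insert _ _)) ?_)
    intro q hq
    -- A corner outside the span of `E` could be added to `E` without losing convex position,
    -- against maximality.
    by_contra hqE
    have hqE' : q ∉ affineSpan ℝ E := fun h => hqE (affineSpan_mono ℝ (Set.subset_insert _ _) h)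
    refine hqE' (subset_affineSpan ℝ _ (hmax (y := insert q E) ⟨hE1.trans (Set.subset_insert _ _),
      Set.insert_subset (Or.inr hq) hE2, hE3.insert hqE'⟩ (Set.subset_insert _ _)
      (Set.mem_insert _ _)))
  have huV : u ∈ V₀ := ⟨hu, hus⟩
  have hgood : IsLatticeVertexSet k (V₀ ∪ E) := by
    refine ⟨Set.union_subset ((Set.sep_subset _ _).trans h.subset) (hE2.trans hVk),
      HullIndep.union i hst (fun a ha => ha.2) hEm (h.indep.mono (Set.sep_subset _ _)) hE3, ?_⟩
    rw [eq_top_iff, ← h.full, hVV]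
    exact affineSpan_mono ℝ (Set.union_subset_union_right _ hE1)
  have hlink : Linked k V (insert u E) :=
    Linked.of_subset_of_subset hgood (hVV.subset.trans (Set.union_subset_union_right _ hE1))
      (Set.insert_subset (Or.inl huV) Set.subset_union_right) h.full hspan
  exact hlink.trans (linked_cubeCorners_of_pyramid hd hk i hEm ⟨w, hE1 ⟨hw, hwt⟩⟩ hut hlink.right)

/-! ### Exchanging a vertex of a simplex -/

/-- The coordinates of an affine basis change by the multiples of `g` along the direction `e`. -/
theorem AffineBasis.coord_add_smul {ι E : Type*} [Fintype ι] [AddCommGroup E] [Module ℝ E]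
    (b : AffineBasis ι ℝ E) {g : ι → ℝ} {e : E} (hg : ∑ j, g j = 0) (he : ∑ j, g j • b j = e)
    (j : ι) (y : E) (t : ℝ) : b.coord j (y + t • e) = b.coord j y + t * g j := by
  classical
  have hlin : (b.coord j).linear e = g j := by
    have h1 : e = ∑ l, g l • (b l - b j) := by
      simp only [smul_sub, Finset.sum_sub_distrib, he, ← Finset.sum_smul, hg, zero_smul, sub_zero]
    have h2 : ∀ l, (b.coord j).linear (b l - b j) = (if j = l then 1 else 0) - 1 := by
      intro l
      rw [← vsub_eq_sub, AffineMap.linearMap_vsub, b.coord_apply, b.coord_apply_eq, vsub_eq_sub]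
    rw [h1, map_sum]
    simp only [map_smul, h2, smul_eq_mul, mul_sub, Finset.sum_sub_distrib, mul_one, hg, sub_zero]
    simp
  rw [add_comm, ← vadd_eq_add, AffineMap.map_vadd, map_smul, hlin, vadd_eq_add, smul_eq_mul,
    add_comm]

/-- The negative coordinate keeps `x` out of the simplex. Having two positive ones leaves, for each
vertex `b u`, a positive coordinate `w ≠ u` from which to separate `b u`. -/
theorem AffineBasis.hullIndep_insert {ι : Type*} [Fintype ι] {d : ℕ}
    (b : AffineBasis ι ℝ (Fin d → ℝ)) {x : Fin d → ℝ} {a a' c : ι} (haa : a ≠ a')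
    (ha : 0 < b.coord a x) (ha' : 0 < b.coord a' x) (hc : b.coord c x < 0) :
    HullIndep (insert x (Set.range b)) := by
  classical
  have hx : x ∉ convexHull ℝ (Set.range b) := by
    rw [b.convexHull_eq_nonneg_coord]
    exact fun h => (h c).not_gt hc
  have hxr : x ∉ Set.range b := fun h => hx (subset_convexHull ℝ _ h)
  rintro v (rfl | ⟨u, rfl⟩) h
  · rw [Set.insert_sdiff_self_of_notMem hxr] at h
    exact hx h
  · obtain ⟨w, hwu, hw⟩ : ∃ w, w ≠ u ∧ 0 < b.coord w x := by
      by_cases hau : a = u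
      · exact ⟨a', by rw [← hau]; exact haa.symm, ha'⟩
      · exact ⟨a, hau, ha⟩
    -- This function is nonpositive at `x` and at the vertices other than `b u`, but takes the
    -- positive value `b.coord w x` at `b u`.
    let f : (Fin d → ℝ) →ᵃ[ℝ] ℝ :=
      b.coord w x • b.coord u - max (b.coord u x) 0 • b.coord w
    have hf : ∀ y, f y = b.coord w x * b.coord u y - max (b.coord u x) 0 * b.coord w y :=
      fun y => rfl
    have hconv : Convex ℝ (f ⁻¹' Set.Iic 0) := (convex_Iic 0).affine_preimage f
    have hsub : insert x (Set.range b) \ {b u} ⊆ f ⁻¹' Set.Iic 0 := by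
      rintro y ⟨rfl | ⟨l, rfl⟩, hne⟩
      · rw [Set.mem_preimage, Set.mem_Iic, hf]
        nlinarith [le_max_left (b.coord u y) 0]
      · have hlu : u ≠ l := by
          rintro rfl
          exact hne rfl
        rw [Set.mem_preimage, Set.mem_Iic, hf, b.coord_apply_ne hlu, b.coord_apply]
        have := le_max_right (b.coord u x) 0
        split_ifs <;> linarith
    have := convexHull_min hsub hconv h
    rw [Set.mem_preimage, Set.mem_Iic, hf, b.coord_apply_eq, b.coord_apply_ne hwu] at this
    linarith

/-- Replacing a vertex of a simplex. -/
theorem AffineBasis.exists_update {ι : Type*} [Fintype ι] [DecidableEq ι] {d : ℕ}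
    (b : AffineBasis ι ℝ (Fin d → ℝ)) {x : Fin d → ℝ} {u : ι} (hu : b.coord u x ≠ 0) :
    ∃ b' : AffineBasis ι ℝ (Fin d → ℝ), ⇑b' = Function.update b u x := by
  have hind : AffineIndependent ℝ (Function.update b u x) := by
    refine b.ind.affineIndependent_update_of_notMem_affineSpan fun h => hu ?_
    have : affineSpan ℝ (b '' {l | l ≠ u}) ≤
        (AffineSubspace.mk' (0 : ℝ) ⊥).comap (b.coord u) := by
      refine affineSpan_le.2 ?_
      rintro _ ⟨l, hl, rfl⟩
      simp [AffineSubspace.mem_mk', b.coord_apply_ne (Ne.symm hl)]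
    simpa [AffineSubspace.mem_mk'] using this h
  have hcard := b.card_eq_finrank_add_one
  exact ⟨⟨Function.update b u x, hind, hind.affineSpan_eq_top_iff_card_eq_finrank_add_one.2 hcard⟩,
    rfl⟩

/-- With the old coefficients, the moved vertices combine to `(1 + t * g u) • e`; dividing restores
`e`. The sign of this factor decides whether the signs of `g` flip. -/
theorem sum_smul_update_eq {ι : Type*} [Fintype ι] [DecidableEq ι] {d : ℕ}
    {b b' : ι → Fin d → ℝ} {g : ι → ℝ} {e : Fin d → ℝ} (hg : ∑ j, g j = 0)
    (he : ∑ j, g j • b j = e) {u : ι} {t : ℝ} (ht : 1 + t * g u ≠ 0)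
    (hb' : b' = Function.update b u (b u + t • e)) :
    ∑ j, (1 + t * g u)⁻¹ * g j = 0 ∧ ∑ j, ((1 + t * g u)⁻¹ * g j) • b' j = e := by
  constructor
  · rw [← Finset.mul_sum, hg, mul_zero]
  · have h1 : ∀ j, b' j = b j + (if j = u then t else 0) • e := by
      intro j
      rw [hb']
      rcases eq_or_ne j u with rfl | h
      · simp
      · simp [h]
    simp only [mul_smul, ← Finset.smul_sum, h1, smul_add, Finset.sum_add_distrib, he]
    have h2 : ∑ j, g j • (if j = u then t else 0) • e = (t * g u) • e := by
      rw [Finset.sum_eq_single u]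
      · simp [smul_smul, mul_comm]
      · intro j _ hj
        simp [hj]
      · simp
    rw [h2, ← smul_add, show e + (t * g u) • e = (1 + t * g u) • e by rw [add_smul, one_smul],
      smul_smul, inv_mul_cancel₀ ht, one_smul]

theorem IsLatticeVertexSet.of_affineBasis {ι : Type*} {d k : ℕ} (b : AffineBasis ι ℝ (Fin d → ℝ))
    (hb : ∀ j, b j ∈ latticeCube d k) : IsLatticeVertexSet k (Set.range b) where
  subset := Set.range_subset_iff.2 hb
  indep := by
    classical
    rintro _ ⟨j, rfl⟩ h
    have hsub : Set.range b \ {b j} ⊆ b.coord j ⁻¹' Set.Iic 0 := by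
      rintro _ ⟨⟨l, rfl⟩, hne⟩
      have hjl : j ≠ l := by
        rintro rfl
        exact hne rfl
      simp [b.coord_apply_ne hjl]
    have := convexHull_min hsub ((convex_Iic 0).affine_preimage (b.coord j)) h
    rw [Set.mem_preimage, b.coord_apply_eq] at this
    exact absurd this (by simp)
  full := b.tot

/-- Moving a vertex `b u` of a lattice simplex by `t` in the direction of a coordinate axis. -/
theorem linked_update {ι : Type*} [Fintype ι] [DecidableEq ι] {d k : ℕ} (i : Fin d)
    {b : AffineBasis ι ℝ (Fin d → ℝ)} (hb : ∀ j, b j ∈ latticeCube d k) {g : ι → ℝ}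
    (hg : ∑ j, g j = 0) (he : ∑ j, g j • b j = Pi.single i 1) {u : ι} {t : ℝ}
    (hut : ∃ m : ℕ, m ≤ k ∧ b u i + t = m) (hu : 1 + t * g u ≠ 0) {a a' c : ι} (haa : a ≠ a')
    (ha : 0 < (if a = u then 1 else 0) + t * g a) (ha' : 0 < (if a' = u then 1 else 0) + t * g a')
    (hc : (if c = u then 1 else 0) + t * g c < 0) :
    ∃ b' : AffineBasis ι ℝ (Fin d → ℝ), Linked k (Set.range b) (Set.range b') ∧
      ⇑b' = Function.update b u (b u + t • Pi.single i 1) := by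
  have hcoord : ∀ j, b.coord j (b u + t • Pi.single i 1) = (if j = u then 1 else 0) + t * g j :=
    fun j => by rw [b.coord_add_smul hg he, b.coord_apply]
  obtain ⟨b', hb'⟩ := b.exists_update (x := b u + t • Pi.single i 1) (u := u)
    (by rw [hcoord, if_pos rfl]; exact hu)
  refine ⟨b', ?_, hb'⟩
  have hx : b u + t • Pi.single i 1 ∈ latticeCube d k := by
    intro l
    rcases eq_or_ne l i with rfl | hl
    · simpa using hut
    · simpa [hl] using hb u l
  have hgood : IsLatticeVertexSet k (insert (b u + t • Pi.single i 1) (Set.range b)) := by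
    refine ⟨Set.insert_subset hx (Set.range_subset_iff.2 hb),
      b.hullIndep_insert (a := a) (a' := a') (c := c) haa ?_ ?_ ?_,
      top_le_iff.1 (b.tot ▸ affineSpan_mono ℝ (Set.subset_insert _ _))⟩
    all_goals rwa [hcoord]
  refine Linked.of_subset_of_subset hgood (Set.subset_insert _ _) ?_ b.tot b'.tot
  rintro _ ⟨j, rfl⟩
  rw [hb']
  rcases eq_or_ne j u with rfl | h
  · simp
  · right
    exact ⟨j, by simp [h]⟩

/-! ### Flattening a simplex along an axis -/

/-- If vertices failing the condition `T` on their `i`-th coordinate can always be moved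
one by one along the `i`-th axis to satisfy it, then they can all be moved. -/
theorem exists_linked_of_moves {ι : Type*} [Fintype ι] [DecidableEq ι] {d k : ℕ} (i : Fin d)
    (H : (ι → ℝ) → Prop) (T : ι → ℝ → Prop)
    (hmove : ∀ (g : ι → ℝ) (u : ι) (m : ℕ), m ≤ k → H g → ¬ T u m → ∃ n : ℕ, n ≤ k ∧ T u n ∧
      1 + ((n : ℝ) - m) * g u ≠ 0 ∧ H (fun j => (1 + ((n : ℝ) - m) * g u)⁻¹ * g j) ∧
      ∃ a a' c, a ≠ a' ∧ 0 < (if a = u then 1 else 0) + ((n : ℝ) - m) * g a ∧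
        0 < (if a' = u then 1 else 0) + ((n : ℝ) - m) * g a' ∧
        (if c = u then 1 else 0) + ((n : ℝ) - m) * g c < 0)
    {b : AffineBasis ι ℝ (Fin d → ℝ)} (hb : ∀ j, b j ∈ latticeCube d k) {g : ι → ℝ}
    (hg : ∑ j, g j = 0) (he : ∑ j, g j • b j = Pi.single i 1) (hH : H g) :
    ∃ b' : AffineBasis ι ℝ (Fin d → ℝ), Linked k (Set.range b) (Set.range b') ∧
      (∀ j, T j (b' j i)) ∧ ∀ j, T j (b j i) → b' j = b j := by
  have key : ∀ s : Finset ι, ∃ (b' : AffineBasis ι ℝ (Fin d → ℝ)) (g' : ι → ℝ),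
      Linked k (Set.range b) (Set.range b') ∧ ∑ j, g' j = 0 ∧
      ∑ j, g' j • b' j = Pi.single i 1 ∧ H g' ∧ (∀ j ∈ s, T j (b' j i)) ∧
      ∀ j, (j ∉ s ∨ T j (b j i)) → b' j = b j := by
    intro s
    induction s using Finset.induction_on with
    | empty =>
      exact ⟨b, g, Linked.refl (IsLatticeVertexSet.of_affineBasis b hb), hg, he, hH, by simp,
        fun _ _ => rfl⟩
    | @insert u s hus ih =>
      obtain ⟨b', g', hlink, hg', he', hH', hT, hfix⟩ := ih
      by_cases hu : T u (b u i)
      · refine ⟨b', g', hlink, hg', he', hH', ?_, fun j hj => hfix j ?_⟩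
        · intro j hj
          rcases Finset.mem_insert.1 hj with rfl | hj
          · rwa [hfix j (Or.inr hu)]
          · exact hT j hj
        · exact hj.imp_left fun h h' => h (Finset.mem_insert_of_mem h')
      · have hb' : ∀ j, b' j ∈ latticeCube d k := fun j => hlink.right.subset ⟨j, rfl⟩
        have hbu : b' u = b u := hfix u (Or.inl hus)
        obtain ⟨m, hm, hum⟩ := hb' u i
        obtain ⟨n, hn, hTn, hne, hHn, a, a', c, haa, ha, ha', hc⟩ :=
          hmove g' u m hm hH' (by rwa [← hum, hbu])
        obtain ⟨b'', hlink', hb''⟩ :=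
          linked_update i hb' hg' he' ⟨n, hn, by rw [hum]; ring⟩ hne haa ha ha' hc
        obtain ⟨h1, h2⟩ := sum_smul_update_eq hg' he' hne hb''
        have hother : ∀ j ≠ u, b'' j = b' j := fun j hj => by rw [hb'']; simp [hj]
        refine ⟨b'', _, hlink.trans hlink', h1, h2, hHn, fun j hj => ?_, fun j hj => ?_⟩
        · rcases eq_or_ne j u with rfl | hju
          · have : b'' j i = n := by
              rw [hb'']
              simp [hum]
            rwa [this]
          · rw [hother j hju]
            exact hT j (Finset.mem_of_mem_insert_of_ne hj hju)
        · have hju : j ≠ u := by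
            rintro rfl
            exact hj.elim (fun h => h (Finset.mem_insert_self _ _)) hu
          rw [hother j hju]
          exact hfix j (hj.imp_left fun h h' => h (Finset.mem_insert_of_mem h'))
  obtain ⟨b', g', hlink, -, -, -, hT, hfix⟩ := key Finset.univ
  exact ⟨b', hlink, fun j => hT j (Finset.mem_univ j), fun j hj => hfix j (Or.inr hj)⟩

theorem ite_one_zero_add_pos {p : Prop} [Decidable p] {x : ℝ} (hx : 0 < x) :
    0 < (if p then 1 else 0) + x := by
  split_ifs <;> linarith

section Moves

variable {ι : Type*} [Fintype ι] [DecidableEq ι] {d k : ℕ} (i : Fin d)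
  {b : AffineBasis ι ℝ (Fin d → ℝ)} (hb : ∀ j, b j ∈ latticeCube d k) {g : ι → ℝ}
  (hg : ∑ j, g j = 0) (he : ∑ j, g j • b j = Pi.single i 1)

include hb hg he

/-- Two entries of each sign remain under rescaling by any nonzero factor, and provide two positive
coordinates and a negative one away from the moved vertex. -/
theorem exists_linked_two_layers_of_pos_neg {p p' n n' : ι} (hk : 0 < k) (hpp : p ≠ p')
    (hnn : n ≠ n') (hp : 0 < g p) (hp' : 0 < g p') (hn : g n < 0) (hn' : g n' < 0) :
    ∃ b' : AffineBasis ι ℝ (Fin d → ℝ), Linked k (Set.range b) (Set.range b') ∧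
      ∀ j, b' j i = 0 ∨ b' j i = k := by
  have key := exists_linked_of_moves (b := b) (g := g) (k := k) i
    (fun g => ∃ p p' n n', p ≠ p' ∧ n ≠ n' ∧ 0 < g p ∧ 0 < g p' ∧ g n < 0 ∧ g n' < 0)
    (fun _ y => y = 0 ∨ y = k)
    (hb := hb) (hg := hg) (he := he) (hH := ⟨p, p', n, n', hpp, hnn, hp, hp', hn, hn'⟩) ?_
  · obtain ⟨b', hlink, hT, -⟩ := key
    exact ⟨b', hlink, hT⟩
  · rintro g u m hm ⟨p, p', n, n', hpp, hnn, hp, hp', hn, hn'⟩ hT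
    push Not at hT
    have hm0 : (0 : ℝ) < m := lt_of_le_of_ne m.cast_nonneg hT.1.symm
    have hmk : (m : ℝ) < k := lt_of_le_of_ne (by exact_mod_cast hm) hT.2
    obtain ⟨l, hl, hTl, hml, hne⟩ : ∃ l : ℕ, l ≤ k ∧ ((l : ℝ) = 0 ∨ (l : ℝ) = k) ∧
        (l : ℝ) - m ≠ 0 ∧ 1 + ((l : ℝ) - m) * g u ≠ 0 := by
      -- The moves to heights `0` and `k` cannot both degenerate, as subtracting the two equations
      -- would give `k * g u = 0`.
      by_cases h0 : 1 + ((k : ℝ) - m) * g u = 0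
      · refine ⟨0, Nat.zero_le _, Or.inl (by simp), by simpa using hT.1, fun h => ?_⟩
        rw [Nat.cast_zero] at h
        have : (k : ℝ) * g u = 0 := by linarith
        have hgu : g u = 0 := (mul_eq_zero.1 this).resolve_left (by positivity)
        simp [hgu] at h
      · exact ⟨k, le_rfl, Or.inr rfl, by linarith, h0⟩
    refine ⟨l, hl, hTl, hne, ?_, ?_⟩
    · rcases (inv_ne_zero hne).lt_or_gt with h | h
      · exact ⟨n, n', p, p', hnn, hpp, mul_pos_of_neg_of_neg h hn, mul_pos_of_neg_of_neg h hn',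
          mul_neg_of_neg_of_pos h hp, mul_neg_of_neg_of_pos h hp'⟩
      · exact ⟨p, p', n, n', hpp, hnn, mul_pos h hp, mul_pos h hp',
          mul_neg_of_pos_of_neg h hn, mul_neg_of_pos_of_neg h hn'⟩
    · rcases hml.lt_or_gt with h | h
      · obtain ⟨c, hcu, hc⟩ : ∃ c, c ≠ u ∧ 0 < g c := by
          by_cases hpu : p = u
          · exact ⟨p', by rw [← hpu]; exact hpp.symm, hp'⟩
          · exact ⟨p, hpu, hp⟩
        refine ⟨n, n', c, hnn, ite_one_zero_add_pos (mul_pos_of_neg_of_neg h hn),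
          ite_one_zero_add_pos (mul_pos_of_neg_of_neg h hn'), ?_⟩
        rw [if_neg hcu, zero_add]
        exact mul_neg_of_neg_of_pos h hc
      · obtain ⟨c, hcu, hc⟩ : ∃ c, c ≠ u ∧ g c < 0 := by
          by_cases hnu : n = u
          · exact ⟨n', by rw [← hnu]; exact hnn.symm, hn'⟩
          · exact ⟨n, hnu, hn⟩
        refine ⟨p, p', c, hpp, ite_one_zero_add_pos (mul_pos h hp),
          ite_one_zero_add_pos (mul_pos h hp'), ?_⟩
        rw [if_neg hcu, zero_add]
        exact mul_neg_of_pos_of_neg h hc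

/-- A vertex other than `p` has `g u ≤ 0`, so moving it down rescales `g` by a positive factor and
preserves its signs. The coordinate at `p` becomes negative. -/
theorem exists_linked_two_layers_of_unique_pos {p n n' : ι} (hnn : n ≠ n') (hp : 0 < g p)
    (hle : ∀ j ≠ p, g j ≤ 0) (hn : g n < 0) (hn' : g n' < 0) :
    ∃ b' : AffineBasis ι ℝ (Fin d → ℝ), Linked k (Set.range b) (Set.range b') ∧
      ∀ j, j = p ∨ b' j i = 0 := by
  have key := exists_linked_of_moves (b := b) (g := g) (k := k) i
    (fun g => 0 < g p ∧ (∀ j ≠ p, g j ≤ 0) ∧ g n < 0 ∧ g n' < 0)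
    (fun j y => j = p ∨ y = 0)
    (hb := hb) (hg := hg) (he := he) (hH := ⟨hp, hle, hn, hn'⟩) ?_
  · obtain ⟨b', hlink, hT, -⟩ := key
    exact ⟨b', hlink, hT⟩
  · rintro g u m hm ⟨hp, hle, hn, hn'⟩ hT
    push Not at hT
    have hm0 : ((0 : ℕ) : ℝ) - m < 0 := by
      rw [Nat.cast_zero, zero_sub, neg_lt_zero]
      exact lt_of_le_of_ne m.cast_nonneg hT.2.symm
    have hpos : 0 < 1 + (((0 : ℕ) : ℝ) - m) * g u := by
      have := mul_nonneg_of_nonpos_of_nonpos hm0.le (hle u hT.1)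
      linarith
    have hinv := inv_pos.2 hpos
    refine ⟨0, Nat.zero_le _, Or.inr (by simp), hpos.ne', ⟨mul_pos hinv hp,
      fun j hj => mul_nonpos_of_nonneg_of_nonpos hinv.le (hle j hj),
      mul_neg_of_pos_of_neg hinv hn, mul_neg_of_pos_of_neg hinv hn'⟩, n, n', p, hnn,
      ite_one_zero_add_pos (mul_pos_of_neg_of_neg hm0 hn),
      ite_one_zero_add_pos (mul_pos_of_neg_of_neg hm0 hn'), ?_⟩
    rw [if_neg (Ne.symm hT.1), zero_add]
    exact mul_neg_of_neg_of_pos hm0 hp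

/-- The mirror image of the unique positive case: the vertices other than `n` move up. -/
theorem exists_linked_two_layers_of_unique_neg {n p p' : ι} (hpp : p ≠ p') (hn : g n < 0)
    (hle : ∀ j ≠ n, 0 ≤ g j) (hp : 0 < g p) (hp' : 0 < g p') :
    ∃ b' : AffineBasis ι ℝ (Fin d → ℝ), Linked k (Set.range b) (Set.range b') ∧
      ∀ j, j = n ∨ b' j i = k := by
  have key := exists_linked_of_moves (b := b) (g := g) (k := k) i
    (fun g => g n < 0 ∧ (∀ j ≠ n, 0 ≤ g j) ∧ 0 < g p ∧ 0 < g p')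
    (fun j y => j = n ∨ y = k)
    (hb := hb) (hg := hg) (he := he) (hH := ⟨hn, hle, hp, hp'⟩) ?_
  · obtain ⟨b', hlink, hT, -⟩ := key
    exact ⟨b', hlink, hT⟩
  · rintro g u m hm ⟨hn, hle, hp, hp'⟩ hT
    push Not at hT
    have hmk : (0 : ℝ) < k - m :=
      sub_pos.2 (lt_of_le_of_ne (by exact_mod_cast hm) hT.2)
    have hpos : 0 < 1 + ((k : ℝ) - m) * g u := by
      have := mul_nonneg hmk.le (hle u hT.1)
      linarith
    have hinv := inv_pos.2 hpos
    refine ⟨k, le_rfl, Or.inr rfl, hpos.ne', ⟨mul_neg_of_pos_of_neg hinv hn,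
      fun j hj => mul_nonneg hinv.le (hle j hj), mul_pos hinv hp, mul_pos hinv hp'⟩, p, p', n, hpp,
      ite_one_zero_add_pos (mul_pos hmk hp), ite_one_zero_add_pos (mul_pos hmk hp'), ?_⟩
    rw [if_neg (Ne.symm hT.1), zero_add]
    exact mul_neg_of_pos_of_neg hmk hn

/-- Here the edge from `b n` to `b p` is parallel to the axis. Moved vertices have `g u = 0`, so `g`
does not change, and the moved vertex itself supplies one of the two positive coordinates. -/
theorem exists_linked_two_layers_of_edge {p n : ι} (hp : 0 < g p) (hn : g n < 0)
    (h0 : ∀ j, j ≠ p → j ≠ n → g j = 0) :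
    ∃ b' : AffineBasis ι ℝ (Fin d → ℝ), Linked k (Set.range b) (Set.range b') ∧
      ∀ j, j = p ∨ b' j i = b n i := by
  obtain ⟨l, hl, hnl⟩ := hb n i
  have key := exists_linked_of_moves (b := b) (g := g) (k := k) i
    (fun g => 0 < g p ∧ g n < 0 ∧ ∀ j, j ≠ p → j ≠ n → g j = 0)
    (fun j y => j = p ∨ j = n ∨ y = l)
    (hb := hb) (hg := hg) (he := he) (hH := ⟨hp, hn, h0⟩) ?_
  · obtain ⟨b', hlink, hT, hfix⟩ := key
    refine ⟨b', hlink, fun j => (hT j).imp_right ?_⟩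
    rintro (rfl | h)
    · rw [hfix j (Or.inr (Or.inl rfl))]
    · rw [h, hnl]
  · rintro g u m hm ⟨hp, hn, h0⟩ hT
    push Not at hT
    obtain ⟨hup, hun, hml⟩ := hT
    have hgu := h0 u hup hun
    refine ⟨l, hl, Or.inr (Or.inr rfl), by simp [hgu], by simpa [hgu] using ⟨hp, hn, h0⟩, ?_⟩
    have hu : 0 < (if u = u then 1 else 0) + ((l : ℝ) - m) * g u := by simp [hgu]
    rcases (sub_ne_zero.2 (Ne.symm hml)).lt_or_gt with h | h
    · refine ⟨u, n, p, hun, hu, ite_one_zero_add_pos (mul_pos_of_neg_of_neg h hn), ?_⟩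
      rw [if_neg (Ne.symm hup), zero_add]
      exact mul_neg_of_neg_of_pos h hp
    · refine ⟨u, p, n, hup, hu, ite_one_zero_add_pos (mul_pos h hp), ?_⟩
      rw [if_neg (Ne.symm hun), zero_add]
      exact mul_neg_of_pos_of_neg h hn

end Moves

/-- Every lattice simplex is linked to one whose vertices lie in two layers. -/
theorem exists_linked_two_layers {ι : Type*} [Fintype ι] {d k : ℕ} (hk : 0 < k) (i : Fin d)
    {b : AffineBasis ι ℝ (Fin d → ℝ)} (hb : ∀ j, b j ∈ latticeCube d k) :
    ∃ (V : Set (Fin d → ℝ)) (s t : ℝ), Linked k (Set.range b) V ∧ ∀ v ∈ V, v i = s ∨ v i = t := by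
  classical
  -- The barycentric coordinates of the axis direction, as a difference of those of two points.
  let g : ι → ℝ := fun j => b.coord j (Pi.single i 1) - b.coord j 0
  have hg : ∑ j, g j = 0 := by
    rw [Finset.sum_sub_distrib, b.sum_coord_apply_eq_one, b.sum_coord_apply_eq_one, sub_self]
  have he : ∑ j, g j • b j = Pi.single i 1 := by
    simp only [g, sub_smul, Finset.sum_sub_distrib, b.linear_combination_coord_eq_self, sub_zero]
  have hg0 : ∃ j ∈ Finset.univ, g j ≠ 0 := by
    by_contra! h
    have := congrFun he i
    simp [h] at this
  obtain ⟨p, -, hp⟩ := Finset.exists_pos_of_sum_zero_of_exists_nonzero g hg hg0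
  obtain ⟨n, -, hn⟩ : ∃ n ∈ Finset.univ, g n < 0 := by
    by_contra! h
    exact (Finset.sum_pos' h ⟨p, Finset.mem_univ p, hp⟩).ne' hg
  have finish : ∀ {a : ι} {s : ℝ} {b' : AffineBasis ι ℝ (Fin d → ℝ)},
      Linked k (Set.range b) (Set.range b') → (∀ j, j = a ∨ b' j i = s) →
      ∃ (V : Set (Fin d → ℝ)) (s t : ℝ),
        Linked k (Set.range b) V ∧ ∀ v ∈ V, v i = s ∨ v i = t := by
    intro a s b' hlink h
    refine ⟨_, b' a i, s, hlink, ?_⟩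
    rintro _ ⟨j, rfl⟩
    exact (h j).imp_left fun h => by rw [h]
  by_cases h2p : ∃ p' ≠ p, 0 < g p' <;> by_cases h2n : ∃ n' ≠ n, g n' < 0
  · obtain ⟨p', hpp, hp'⟩ := h2p
    obtain ⟨n', hnn, hn'⟩ := h2n
    obtain ⟨b', hlink, h⟩ :=
      exists_linked_two_layers_of_pos_neg i hb hg he hk hpp.symm hnn.symm hp hp' hn hn'
    refine ⟨_, 0, k, hlink, ?_⟩
    rintro _ ⟨j, rfl⟩
    exact h j
  · push Not at h2n
    obtain ⟨p', hpp, hp'⟩ := h2p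
    obtain ⟨b', hlink, h⟩ :=
      exists_linked_two_layers_of_unique_neg i hb hg he hpp.symm hn h2n hp hp'
    exact finish hlink h
  · push Not at h2p
    obtain ⟨n', hnn, hn'⟩ := h2n
    obtain ⟨b', hlink, h⟩ :=
      exists_linked_two_layers_of_unique_pos i hb hg he hnn.symm hp h2p hn hn'
    exact finish hlink h
  · push Not at h2p h2n
    obtain ⟨b', hlink, h⟩ := exists_linked_two_layers_of_edge i hb hg he hp hn
      fun j hjp hjn => le_antisymm (h2p j hjp) (h2n j hjn)
    exact finish hlink h

/-! ### Assembling the path to the cube -/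

theorem IsLatticeVertexSet.exists_linked_range {d k : ℕ} {V : Set (Fin d → ℝ)}
    (hV : IsLatticeVertexSet k V) : ∃ (W : Set (Fin d → ℝ)) (_ : Finite W)
      (b : AffineBasis W ℝ (Fin d → ℝ)), Linked k V (Set.range b) := by
  obtain ⟨W, hWV, hspan, hind⟩ := exists_affineIndependent ℝ (Fin d → ℝ) V
  rw [hV.full] at hspan
  refine ⟨W, hV.finite.subset hWV, ⟨_, hind, by rwa [Subtype.range_coe]⟩, ?_⟩
  have : Linked k V W := (Linked.of_subset hV hWV hspan).symm
  convert this
  exact Subtype.range_coe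

theorem IsLatticeVertexSet.linked_cubeCorners {d k : ℕ} (hd : 2 ≤ d) (hk : 0 < k)
    {V : Set (Fin d → ℝ)} (hV : IsLatticeVertexSet k V) : Linked k V (cubeCorners d k) := by
  obtain ⟨W, hW, b, hlink⟩ := hV.exists_linked_range
  have := Fintype.ofFinite W
  let i : Fin d := ⟨0, by omega⟩
  obtain ⟨U, s, t, hlink', hU⟩ :=
    exists_linked_two_layers hk i (b := b) fun j => hlink.right.subset ⟨j, rfl⟩
  exact (hlink.trans hlink').trans (linked_cubeCorners_of_two_layers hd hk i hlink'.right hU)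

theorem isLatticeVertexSet_cubeCorners {d k : ℕ} (hd : 2 ≤ d) (hk : 0 < k) :
    IsLatticeVertexSet k (cubeCorners d k) := by
  let i : Fin d := ⟨0, by omega⟩
  have h0 : (0 : ℝ) ≠ k := by positivity
  have hC : (0 : Fin d → ℝ) ∈ cornerLayer k i 0 := ⟨rfl, fun _ _ => Or.inl rfl⟩
  rw [← cornerLayer_union_cornerLayer i]
  have hz := hullIndep_cornerLayer (d := d) i (Nat.zero_le k)
  have hzs := cornerLayer_subset (d := d) i (Nat.zero_le k)
  rw [Nat.cast_zero] at hz hzs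
  refine ⟨Set.union_subset hzs (cornerLayer_subset i le_rfl),
    HullIndep.union i h0 (fun a ha => ha.1) (fun b hb => hb.1) hz (hullIndep_cornerLayer i le_rfl),
    top_le_iff.1 ?_⟩
  rw [← affineSpan_insert_cornerLayer (d := d) hk i (t := k) (u := 0) h0]
  exact affineSpan_mono ℝ (Set.insert_subset (Or.inl hC) Set.subset_union_right)

theorem mainTheorem4 (d k : ℕ) (hd : 2 ≤ d) (hk : 0 < k) :
    (latticePolytopeGraph d k).Connected :=
  connected_of_linked (isLatticeVertexSet_cubeCorners hd hk) fun _ hV => hV.linked_cubeCorners hd hk
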